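/- Let $\Omega\subseteq\mathbb{R}^n$. An interval function on $\Omega$ is a map $f=[\underline f,\overline f]$ from $\Omega$ to the compact real intervals, with $\underline f\le\overline f$. It is locally bounded if every $x\in\Omega$ has $\delta>0$ and $M$ with $\max\{|\underline f(y)|,|\overline f(y)|\}<M$ for all $y\in B_\delta(x)=\{y\in\Omega:\|x-y\|<\delta\}$. For locally bounded $f$ put $$F(f)(x)=\Big[\sup_{\delta>0}\inf_{y\in B_\delta(x)}\underline f(y),\ \inf_{\delta>0}\sup_{y\in B_\delta(x)}\overline f(y)\Big].$$ A locally bounded $f$ is Hausdorff continuous if $F(g)=f$ for every locally bounded interval function $g$ with $g(x)\subseteq f(x)$ for all $x\in\Omega$. Let $\mathbb{H}(\Omega)$ be the set of Hausdorff continuous functions, ordered by $f\le g$ iff $\underline f\le\underline g$ and $\overline f\le\overline g$ pointwise; $C(\Omega)$, the set of continuous real functions, is regarded as a subset of $\mathbb{H}(\Omega)$ by identifying $a$ with $[a,a]$. Intervals are added and multiplied by $a+b=\{s+t:s\in a,\,t\in b\}$ and $a\times b=\{st:s\in a,\,t\in b\}$. A sequence $(\xi_k)$ in a partially ordered set order converges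 to $p$ if there are an increasing sequence $(\alpha_k)$ and a decreasing sequence $(\beta_k)$ with $\alpha_k\le\xi_k\le\beta_k$ for all $k$ and $\sup_k\alpha_k=p=\inf_k\beta_k$. A sequence $(f_k)$ in $C(\Omega)$ is Cauchy if there is a decreasing sequence $(\beta_k)$ in $C(\Omega)$ with infimum $0$ in $C(\Omega)$ such that $f_m-f_l\le\beta_k$ whenever $m,l\ge k$. Let $f,g\in\mathbb{H}(\Omega)$. Then: 1. There is exactly one $h\in\mathbb{H}(\Omega)$ with $h(x)\subseteq f(x)+g(x)$ for all $x\in\Omega$, and exactly one $q\in\mathbb{H}(\Omega)$ with $q(x)\subseteq f(x)\times g(x)$ for all $x\in\Omega$. 2. There are Cauchy sequences $(f_k)$, $(g_k)$ in $C(\Omega)$ which order converge in $\mathbb{H}(\Omega)$ to $f$ and $g$, respectively; and for every choice of such sequences, $(f_k+g_k)$ and $(f_k g_k)$ order converge in $\mathbb{H}(\Omega)$, each to exactly one limit, which does not depend on the choice. 3. The two ways of defining sum and product agree: the limit of $(f_k+g_k)$ is $h$ and the limit of $(f_kg_k)$ is $q$. -/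

import Mathlib

namespace HausdorffContinuity

/-- `NonemptyInterval ℝ` is the set of all compact real intervals `[a.fst, a.snd]`,
`a.fst ≤ a.snd`; its addition is `[a.fst + b.fst, a.snd + b.snd]`. (Its `≤` in Mathlib is
inclusion, which is not the order used here for functions; inclusion is written with sets.)
The outer product of two intervals: -/
def intervalMul (a b : NonemptyInterval ℝ) : NonemptyInterval ℝ where
  fst := min (min (a.fst * b.fst) (a.fst * b.snd)) (min (a.snd * b.fst) (a.snd * b.snd))
  snd := max (max (a.fst * b.fst) (a.fst * b.snd)) (max (a.snd * b.fst) (a.snd * b.snd))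
  fst_le_snd :=
    ((min_le_left _ _).trans (min_le_left _ _)).trans
      ((le_max_left _ _).trans (le_max_left _ _))

section Baire

variable {X : Type*} [PseudoMetricSpace X]

/-- Local boundedness, with the modulus `|a| = max |a.fst| |a.snd|` of an interval. -/
def LocallyBounded (f : X → NonemptyInterval ℝ) : Prop :=
  ∀ x, ∃ δ > 0, ∃ M : ℝ, ∀ y ∈ Metric.ball x δ, max |(f y).fst| |(f y).snd| < M

/-- `sup_{δ > 0} inf {f y : y ∈ B_δ(x)}`, computed in the extended reals because the infimum
may be `-∞` for large `δ`; for a locally bounded `f` the outcome is finite. -/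
noncomputable def lowerBaire (f : X → NonemptyInterval ℝ) (x : X) : ℝ :=
  (⨆ δ : ℝ, ⨆ _ : 0 < δ, ⨅ y ∈ Metric.ball x δ, ((f y).fst : EReal)).toReal

/-- `inf_{δ > 0} sup {f y : y ∈ B_δ(x)}`, computed in the extended reals. -/
noncomputable def upperBaire (f : X → NonemptyInterval ℝ) (x : X) : ℝ :=
  (⨅ δ : ℝ, ⨅ _ : 0 < δ, ⨆ y ∈ Metric.ball x δ, ((f y).snd : EReal)).toReal

theorem le_lowerBaire {f : X → NonemptyInterval ℝ} {x : X} {c δ : ℝ} (hδ : 0 < δ)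
    (h : ∀ y ∈ Metric.ball x δ, c ≤ (f y).fst) : c ≤ lowerBaire f x := by
  have h1 : (c : EReal) ≤
      ⨆ δ : ℝ, ⨆ _ : 0 < δ, ⨅ y ∈ Metric.ball x δ, ((f y).fst : EReal) :=
    le_iSup₂_of_le δ hδ (le_iInf₂ fun y hy => EReal.coe_le_coe_iff.2 (h y hy))
  have h2 : (⨆ δ : ℝ, ⨆ _ : 0 < δ, ⨅ y ∈ Metric.ball x δ, ((f y).fst : EReal))
      ≤ ((f x).fst : EReal) :=
    iSup₂_le fun δ hδ => iInf₂_le x (Metric.mem_ball_self hδ)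
  have h3 := EReal.toReal_le_toReal h1 (EReal.coe_ne_bot c)
    (ne_top_of_le_ne_top (EReal.coe_ne_top _) h2)
  simpa [lowerBaire] using h3

theorem upperBaire_le {f : X → NonemptyInterval ℝ} {x : X} {c δ : ℝ} (hδ : 0 < δ)
    (h : ∀ y ∈ Metric.ball x δ, (f y).snd ≤ c) : upperBaire f x ≤ c := by
  have h1 : (⨅ δ : ℝ, ⨅ _ : 0 < δ, ⨆ y ∈ Metric.ball x δ, ((f y).snd : EReal)) ≤ (c : EReal) :=
    iInf₂_le_of_le δ hδ (iSup₂_le fun y hy => EReal.coe_le_coe_iff.2 (h y hy))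
  have h2 : ((f x).snd : EReal) ≤
      ⨅ δ : ℝ, ⨅ _ : 0 < δ, ⨆ y ∈ Metric.ball x δ, ((f y).snd : EReal) :=
    le_iInf₂ fun δ hδ => le_iSup₂_of_le x (Metric.mem_ball_self hδ) le_rfl
  have h3 := EReal.toReal_le_toReal h1
    (ne_bot_of_le_ne_bot (EReal.coe_ne_bot _) h2) (EReal.coe_ne_top c)
  simpa [upperBaire] using h3

theorem lowerBaire_le {f : X → NonemptyInterval ℝ} (hf : LocallyBounded f) (x : X) :
    lowerBaire f x ≤ (f x).fst := by
  obtain ⟨δ, hδ, M, hM⟩ := hf x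
  have h1 : ((-M : ℝ) : EReal) ≤
      ⨆ δ : ℝ, ⨆ _ : 0 < δ, ⨅ y ∈ Metric.ball x δ, ((f y).fst : EReal) :=
    le_iSup₂_of_le δ hδ (le_iInf₂ fun y hy => EReal.coe_le_coe_iff.2
      (abs_le.1 ((le_max_left _ _).trans (hM y hy).le)).1)
  have h2 : (⨆ δ : ℝ, ⨆ _ : 0 < δ, ⨅ y ∈ Metric.ball x δ, ((f y).fst : EReal))
      ≤ ((f x).fst : EReal) :=
    iSup₂_le fun δ hδ => iInf₂_le x (Metric.mem_ball_self hδ)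
  have h3 := EReal.toReal_le_toReal h2
    (ne_bot_of_le_ne_bot (EReal.coe_ne_bot _) h1) (EReal.coe_ne_top _)
  simpa [lowerBaire] using h3

theorem le_upperBaire {f : X → NonemptyInterval ℝ} (hf : LocallyBounded f) (x : X) :
    (f x).snd ≤ upperBaire f x := by
  obtain ⟨δ, hδ, M, hM⟩ := hf x
  have h1 : (⨅ δ : ℝ, ⨅ _ : 0 < δ, ⨆ y ∈ Metric.ball x δ, ((f y).snd : EReal)) ≤ (M : EReal) :=
    iInf₂_le_of_le δ hδ (iSup₂_le fun y hy => EReal.coe_le_coe_iff.2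
      (abs_le.1 ((le_max_right _ _).trans (hM y hy).le)).2)
  have h2 : ((f x).snd : EReal) ≤
      ⨅ δ : ℝ, ⨅ _ : 0 < δ, ⨆ y ∈ Metric.ball x δ, ((f y).snd : EReal) :=
    le_iInf₂ fun δ hδ => le_iSup₂_of_le x (Metric.mem_ball_self hδ) le_rfl
  have h3 := EReal.toReal_le_toReal h2 (EReal.coe_ne_bot _)
    (ne_top_of_le_ne_top (EReal.coe_ne_top _) h1)
  simpa [upperBaire] using h3

/-- The graph completion `F(f) = [I(f), S(f)]` of a locally bounded interval function. -/
noncomputable def graphCompletion (f : X → NonemptyInterval ℝ) (hf : LocallyBounded f) (x : X) :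
    NonemptyInterval ℝ where
  fst := lowerBaire f x
  snd := upperBaire f x
  fst_le_snd := (lowerBaire_le hf x).trans ((f x).fst_le_snd.trans (le_upperBaire hf x))

end Baire

/-- The set of all Hausdorff continuous interval functions on `X`. -/
@[ext]
structure HFun (X : Type*) [PseudoMetricSpace X] where
  toFun : X → NonemptyInterval ℝ
  locallyBounded : LocallyBounded toFun
  hausdorff : ∀ (g : X → NonemptyInterval ℝ) (hg : LocallyBounded g),
    (∀ x, (g x : Set ℝ) ⊆ (toFun x : Set ℝ)) → ∀ x, graphCompletion g hg x = toFun x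

section HFun

variable {X : Type*} [PseudoMetricSpace X]

instance : CoeFun (HFun X) (fun _ => X → NonemptyInterval ℝ) := ⟨HFun.toFun⟩

/-- `f ≤ g` iff, at every point, both end points of `f` are at most those of `g`. -/
instance : PartialOrder (HFun X) where
  le f g := ∀ x, (f x).fst ≤ (g x).fst ∧ (f x).snd ≤ (g x).snd
  le_refl _ _ := ⟨le_rfl, le_rfl⟩
  le_trans _ _ _ h k x := ⟨(h x).1.trans (k x).1, (h x).2.trans (k x).2⟩
  le_antisymm f g h k := HFun.ext <| funext fun x => NonemptyInterval.ext <|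
    Prod.ext (le_antisymm (h x).1 (k x).1) (le_antisymm (h x).2 (k x).2)

/-- A continuous real function, regarded as a (point-valued) Hausdorff continuous function. -/
def ofContinuous (u : C(X, ℝ)) : HFun X where
  toFun x := NonemptyInterval.pure (u x)
  locallyBounded x := by
    obtain ⟨δ, hδ, h⟩ := Metric.continuousAt_iff.1 (u.continuous.continuousAt (x := x)) 1 one_pos
    refine ⟨δ, hδ, |u x| + 1, fun y hy => ?_⟩
    have h1 : |u y - u x| < 1 := h hy
    have h2 := abs_sub_abs_le_abs_sub (u y) (u x)
    change max |u y| |u y| < |u x| + 1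
    rw [max_self]
    linarith
  hausdorff g hg hgu x := by
    have hval : ∀ y, (g y).fst = u y ∧ (g y).snd = u y := by
      intro y
      have h1 : (g y).fst ∈ (NonemptyInterval.pure (u y) : Set ℝ) :=
        hgu y ⟨le_rfl, (g y).fst_le_snd⟩
      have h2 : (g y).snd ∈ (NonemptyInterval.pure (u y) : Set ℝ) :=
        hgu y ⟨(g y).fst_le_snd, le_rfl⟩
      simpa using And.intro h1 h2
    have key : ∀ ε > 0, ∃ δ > 0, ∀ y ∈ Metric.ball x δ, |u y - u x| < ε := fun ε hε =>
      (Metric.continuousAt_iff.1 (u.continuous.continuousAt (x := x)) ε hε).imp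
        fun δ h => ⟨h.1, fun y hy => h.2 hy⟩
    refine NonemptyInterval.ext (Prod.ext (le_antisymm ?_ ?_) (le_antisymm ?_ ?_))
    · exact (lowerBaire_le hg x).trans (hval x).1.le
    · refine le_of_forall_pos_sub_le fun ε hε => ?_
      obtain ⟨δ, hδ, h⟩ := key ε hε
      refine le_lowerBaire hδ fun y hy => ?_
      rw [(hval y).1]
      have := (abs_lt.1 (h y hy)).1
      change u x - ε ≤ u y
      linarith
    · refine le_of_forall_pos_le_add fun ε hε => ?_
      obtain ⟨δ, hδ, h⟩ := key ε hε
      refine upperBaire_le hδ fun y hy => ?_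
      rw [(hval y).2]
      have := (abs_lt.1 (h y hy)).2
      change u y ≤ u x + ε
      linarith
    · exact (hval x).2.ge.trans (le_upperBaire hg x)

end HFun

/-- Order convergence of a sequence in a partially ordered set. -/
def OrderConverges {P : Type*} [PartialOrder P] (ξ : ℕ → P) (p : P) : Prop :=
  ∃ α β : ℕ → P, Monotone α ∧ Antitone β ∧ (∀ n, α n ≤ ξ n ∧ ξ n ≤ β n) ∧
    IsLUB (Set.range α) p ∧ IsGLB (Set.range β) p

/-- `p` is the order limit of `ξ`: `ξ` order converges to `p` and to nothing else. -/
def IsTheOrderLimit {P : Type*} [PartialOrder P] (ξ : ℕ → P) (p : P) : Prop :=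
  OrderConverges ξ p ∧ ∀ q, OrderConverges ξ q → q = p

section Operations

variable {X : Type*} [PseudoMetricSpace X]

/-- Cauchy sequences of continuous functions for the order convergence structure; the infimum
is taken in `C(X, ℝ)`. -/
def IsOrderCauchy (u : ℕ → C(X, ℝ)) : Prop :=
  ∃ β : ℕ → C(X, ℝ), Antitone β ∧ IsGLB (Set.range β) 0 ∧
    ∀ n m k, n ≤ m → n ≤ k → u m - u k ≤ β n

/-- `u` is a Cauchy sequence of continuous functions which order converges to `f` in the set of
Hausdorff continuous functions. -/
def Approximates (u : ℕ → C(X, ℝ)) (f : HFun X) : Prop :=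
  IsOrderCauchy u ∧ OrderConverges (fun n => ofContinuous (u n)) f

/-- `h(x) ⊆ f(x) + g(x)` for all `x`. -/
def IsInclusionSum (f g h : HFun X) : Prop :=
  ∀ x, (h x : Set ℝ) ⊆ ((f x + g x : NonemptyInterval ℝ) : Set ℝ)

/-- `h(x) ⊆ f(x) × g(x)` for all `x`. -/
def IsInclusionProd (f g h : HFun X) : Prop :=
  ∀ x, (h x : Set ℝ) ⊆ (intervalMul (f x) (g x) : Set ℝ)

/-- `h` is the sum of `f` and `g` defined through order convergence: approximating Cauchy
sequences exist, and for every choice of them `h` is the order limit of the sums. -/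
def IsOrderSum (f g h : HFun X) : Prop :=
  (∃ u v : ℕ → C(X, ℝ), Approximates u f ∧ Approximates v g) ∧
  ∀ u v : ℕ → C(X, ℝ), Approximates u f → Approximates v g →
    IsTheOrderLimit (fun n => ofContinuous (u n + v n)) h

/-- `h` is the product of `f` and `g` defined through order convergence: approximating Cauchy
sequences exist, and for every choice of them `h` is the order limit of the products. -/
def IsOrderProd (f g h : HFun X) : Prop :=
  (∃ u v : ℕ → C(X, ℝ), Approximates u f ∧ Approximates v g) ∧
  ∀ u v : ℕ → C(X, ℝ), Approximates u f → Approximates v g →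
    IsTheOrderLimit (fun n => ofContinuous (u n * v n)) h

end Operations

end HausdorffContinuity

/-! Hausdorff continuity amounts to semicontinuity of both end points plus a rigidity: near every x
the lower end point exceeds any number below the upper value at x, and symmetrically
(`HFun.frequently_lt_fst`, `HFun.frequently_snd_lt`; converse `HFun.ofIsSemicontinuous`).

The central tool is an enclosure: semicontinuous interval functions A_n, decreasing in n, such that
for each ε the points where some A_n is narrower than ε are dense. By rigidity at most one Hausdorff
continuous p lies in all A_n (`IsEnclosure.eq`), and then every sequence ξ_n ⊆ A_n order converges
to p (`IsEnclosure.orderConverges`). Conversely, an order convergent sequence and its limit always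
lie in a common enclosure (`OrderConverges.exists_isEnclosure`).

Sum and product both send two intervals to the image of their box under a continuous map, and such
an operation preserves enclosures (`IsImageOperation.isEnclosure`). For the constant enclosures f
and g this makes h ⊆ op(f, g) unique; a hull gives existence. If A_n and B_n enclose the
approximations of f and g, then h ⊆ op(f, g) ⊆ op(A_n, B_n), so h is also the order limit.
Approximating sequences exist by Lipschitz regularization (`exists_approximates`). -/

namespace HausdorffContinuity

open Filter Topology

/-! ### Baire operators and semicontinuous interval functions. -/

section Semicontinuity

variable {X : Type*} [PseudoMetricSpace X]

theorem eventually_lt_of_lt_lowerBaire {f : X → NonemptyInterval ℝ} (hf : LocallyBounded f)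
    {x : X} {c : ℝ} (hc : c < lowerBaire f x) : ∀ᶠ y in 𝓝 x, c < (f y).fst := by
  obtain ⟨δ, hδ, M, hM⟩ := hf x
  have h1 : ((-M : ℝ) : EReal) ≤
      ⨆ δ : ℝ, ⨆ _ : 0 < δ, ⨅ y ∈ Metric.ball x δ, ((f y).fst : EReal) :=
    le_iSup₂_of_le δ hδ (le_iInf₂ fun y hy => EReal.coe_le_coe_iff.2
      (abs_le.1 ((le_max_left _ _).trans (hM y hy).le)).1)
  have h2 : (⨆ δ : ℝ, ⨆ _ : 0 < δ, ⨅ y ∈ Metric.ball x δ, ((f y).fst : EReal))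
      ≤ ((f x).fst : EReal) :=
    iSup₂_le fun δ hδ => iInf₂_le x (Metric.mem_ball_self hδ)
  have h3 := EReal.coe_lt_coe_iff.2 hc
  rw [lowerBaire, EReal.coe_toReal (ne_top_of_le_ne_top (EReal.coe_ne_top _) h2)
    (ne_bot_of_le_ne_bot (EReal.coe_ne_bot _) h1)] at h3
  obtain ⟨r, hr⟩ := lt_iSup_iff.1 h3
  obtain ⟨hr0, hr⟩ := lt_iSup_iff.1 hr
  filter_upwards [Metric.ball_mem_nhds x hr0] with y hy
  exact EReal.coe_lt_coe_iff.1 (hr.trans_le (iInf₂_le y hy))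

theorem eventually_lt_of_upperBaire_lt {f : X → NonemptyInterval ℝ} (hf : LocallyBounded f)
    {x : X} {c : ℝ} (hc : upperBaire f x < c) : ∀ᶠ y in 𝓝 x, (f y).snd < c := by
  obtain ⟨δ, hδ, M, hM⟩ := hf x
  have h1 : (⨅ δ : ℝ, ⨅ _ : 0 < δ, ⨆ y ∈ Metric.ball x δ, ((f y).snd : EReal)) ≤ (M : EReal) :=
    iInf₂_le_of_le δ hδ (iSup₂_le fun y hy => EReal.coe_le_coe_iff.2
      (abs_le.1 ((le_max_right _ _).trans (hM y hy).le)).2)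
  have h2 : ((f x).snd : EReal) ≤
      ⨅ δ : ℝ, ⨅ _ : 0 < δ, ⨆ y ∈ Metric.ball x δ, ((f y).snd : EReal) :=
    le_iInf₂ fun δ hδ => le_iSup₂_of_le x (Metric.mem_ball_self hδ) le_rfl
  have h3 := EReal.coe_lt_coe_iff.2 hc
  rw [upperBaire, EReal.coe_toReal (ne_top_of_le_ne_top (EReal.coe_ne_top _) h1)
    (ne_bot_of_le_ne_bot (EReal.coe_ne_bot _) h2)] at h3
  obtain ⟨r, hr⟩ := iInf_lt_iff.1 h3
  obtain ⟨hr0, hr⟩ := iInf_lt_iff.1 hr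
  filter_upwards [Metric.ball_mem_nhds x hr0] with y hy
  exact EReal.coe_lt_coe_iff.1 ((le_iSup₂ (f := fun y (_ : y ∈ Metric.ball x r) =>
    ((f y).snd : EReal)) y hy).trans_lt hr)

theorem le_lowerBaire_of_eventually {f : X → NonemptyInterval ℝ} {x : X} {c : ℝ}
    (h : ∀ᶠ y in 𝓝 x, c ≤ (f y).fst) : c ≤ lowerBaire f x := by
  obtain ⟨δ, hδ, h⟩ := Metric.eventually_nhds_iff_ball.1 h
  exact le_lowerBaire hδ h

theorem upperBaire_le_of_eventually {f : X → NonemptyInterval ℝ} {x : X} {c : ℝ}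
    (h : ∀ᶠ y in 𝓝 x, (f y).snd ≤ c) : upperBaire f x ≤ c := by
  obtain ⟨δ, hδ, h⟩ := Metric.eventually_nhds_iff_ball.1 h
  exact upperBaire_le hδ h

theorem frequently_lt_of_lt_upperBaire {f : X → NonemptyInterval ℝ} {x : X} {c : ℝ}
    (h : c < upperBaire f x) : ∃ᶠ y in 𝓝 x, c < (f y).snd := by
  refine fun hn => h.not_ge (upperBaire_le_of_eventually ?_)
  filter_upwards [hn] with y hy using not_lt.1 hy

theorem frequently_lt_of_lowerBaire_lt {f : X → NonemptyInterval ℝ} {x : X} {c : ℝ}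
    (h : lowerBaire f x < c) : ∃ᶠ y in 𝓝 x, (f y).fst < c := by
  refine fun hn => h.not_ge (le_lowerBaire_of_eventually ?_)
  filter_upwards [hn] with y hy using not_lt.1 hy

theorem lowerSemicontinuous_lowerBaire {f : X → NonemptyInterval ℝ} (hf : LocallyBounded f) :
    LowerSemicontinuous (lowerBaire f) := by
  refine lowerSemicontinuous_iff.2 fun x c hc => ?_
  obtain ⟨d, hcd, hd⟩ := exists_between hc
  filter_upwards [(eventually_lt_of_lt_lowerBaire hf hd).eventually_nhds] with y hy
  exact hcd.trans_le (le_lowerBaire_of_eventually (hy.mono fun _ h => h.le))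

theorem upperSemicontinuous_upperBaire {f : X → NonemptyInterval ℝ} (hf : LocallyBounded f) :
    UpperSemicontinuous (upperBaire f) := by
  refine upperSemicontinuous_iff.2 fun x c hc => ?_
  obtain ⟨d, hd, hdc⟩ := exists_between hc
  filter_upwards [(eventually_lt_of_upperBaire_lt hf hd).eventually_nhds] with y hy
  exact (upperBaire_le_of_eventually (hy.mono fun _ h => h.le)).trans_lt hdc

/-- An interval function is semicontinuous if its lower end point is lower semicontinuous and its
upper end point is upper semicontinuous. -/
structure IsSemicontinuous (A : X → NonemptyInterval ℝ) : Prop where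
  lower : LowerSemicontinuous fun x => (A x).fst
  upper : UpperSemicontinuous fun x => (A x).snd

theorem IsSemicontinuous.eventually_lower {A : X → NonemptyInterval ℝ} (hA : IsSemicontinuous A)
    {x : X} {c : ℝ} (hc : c < (A x).fst) : ∀ᶠ y in 𝓝 x, c < (A y).fst :=
  lowerSemicontinuous_iff.1 hA.lower x c hc

theorem IsSemicontinuous.eventually_upper {A : X → NonemptyInterval ℝ} (hA : IsSemicontinuous A)
    {x : X} {c : ℝ} (hc : (A x).snd < c) : ∀ᶠ y in 𝓝 x, (A y).snd < c :=
  upperSemicontinuous_iff.1 hA.upper x c hc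

/-- Narrowness is an open condition, so further dense conditions can be met without losing it. -/
theorem IsSemicontinuous.eventually_width {A : X → NonemptyInterval ℝ} (hA : IsSemicontinuous A)
    {x : X} {ε : ℝ} (h : (A x).snd - (A x).fst < ε) :
    ∀ᶠ y in 𝓝 x, (A y).snd - (A y).fst < ε := by
  have h1 := hA.eventually_lower (x := x)
    (c := (A x).fst - (ε - ((A x).snd - (A x).fst)) / 2) (by linarith)
  have h2 := hA.eventually_upper (x := x)
    (c := (A x).snd + (ε - ((A x).snd - (A x).fst)) / 2) (by linarith)
  filter_upwards [h1, h2] with y hy1 hy2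
  linarith

theorem IsSemicontinuous.eventually_bounded {A : X → NonemptyInterval ℝ}
    (hA : IsSemicontinuous A) (x : X) :
    ∃ M : ℝ, ∀ᶠ y in 𝓝 x, -M < (A y).fst ∧ (A y).snd < M := by
  refine ⟨|(A x).fst| + |(A x).snd| + 1, ?_⟩
  have h1 := neg_abs_le (A x).fst
  have h2 := le_abs_self (A x).snd
  have h3 := abs_nonneg (A x).fst
  have h4 := abs_nonneg (A x).snd
  exact (hA.eventually_lower (by linarith)).and (hA.eventually_upper (by linarith))

theorem IsSemicontinuous.neg {A : X → NonemptyInterval ℝ} (hA : IsSemicontinuous A) :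
    IsSemicontinuous fun x => -A x where
  lower := lowerSemicontinuous_iff.2 fun x c (hc : c < -(A x).snd) =>
    (hA.eventually_upper (lt_neg.1 hc)).mono fun _ hy => lt_neg.1 hy
  upper := upperSemicontinuous_iff.2 fun x c (hc : -(A x).fst < c) =>
    (hA.eventually_lower (neg_lt.1 hc)).mono fun _ hy => neg_lt.1 hy

theorem LocallyBounded.of_eventually {A : X → NonemptyInterval ℝ}
    (hA : ∀ x, ∃ M : ℝ, ∀ᶠ y in 𝓝 x, -M < (A y).fst ∧ (A y).snd < M) : LocallyBounded A := by
  intro x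
  obtain ⟨M, hM⟩ := hA x
  obtain ⟨δ, hδ, h⟩ := Metric.eventually_nhds_iff_ball.1 hM
  refine ⟨δ, hδ, M, fun y hy => ?_⟩
  have h1 := h y hy
  have h2 := (A y).fst_le_snd
  exact max_lt (abs_lt.2 ⟨h1.1, h2.trans_lt h1.2⟩) (abs_lt.2 ⟨h1.1.trans_le h2, h1.2⟩)

theorem IsSemicontinuous.locallyBounded {A : X → NonemptyInterval ℝ} (hA : IsSemicontinuous A) :
    LocallyBounded A :=
  .of_eventually hA.eventually_bounded

end Semicontinuity

/-! ### Rigidity of Hausdorff continuous functions, and hulls. -/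

namespace HFun

variable {X : Type*} [PseudoMetricSpace X]

/-- A semicontinuous interval function is Hausdorff continuous as soon as each of its end points
is determined by the values of the other one nearby. -/
def ofIsSemicontinuous (A : X → NonemptyInterval ℝ) (hA : IsSemicontinuous A)
    (h₁ : ∀ x c, c < (A x).snd → ∃ᶠ y in 𝓝 x, c < (A y).fst)
    (h₂ : ∀ x c, (A x).fst < c → ∃ᶠ y in 𝓝 x, (A y).snd < c) : HFun X where
  toFun := A
  locallyBounded := hA.locallyBounded
  hausdorff g hg hgA x := by
    have hle : ∀ y, (A y).fst ≤ (g y).fst ∧ (g y).snd ≤ (A y).snd := fun y =>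
      NonemptyInterval.le_def.1 (NonemptyInterval.coe_subset_coe.1 (hgA y))
    refine NonemptyInterval.ext (Prod.ext (le_antisymm ?_ ?_) (le_antisymm ?_ ?_))
    -- For c strictly between the two values, c < g.fst holds throughout a neighbourhood, while
    -- A.snd < c, hence g.snd < c, holds somewhere in it.
    · refine le_of_not_gt fun h => ?_
      obtain ⟨c, hc, hc'⟩ := exists_between h
      obtain ⟨y, hy, hy'⟩ := ((h₂ x c hc).and_eventually
        (eventually_lt_of_lt_lowerBaire hg hc')).exists
      exact (hy'.trans_le ((g y).fst_le_snd.trans (hle y).2)).not_gt hy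
    · refine le_of_forall_lt fun c hc => ?_
      obtain ⟨d, hcd, hd⟩ := exists_between hc
      exact hcd.trans_le (le_lowerBaire_of_eventually
        ((hA.eventually_lower hd).mono fun y hy => hy.le.trans (hle y).1))
    · refine le_of_forall_gt fun c hc => ?_
      obtain ⟨d, hd, hdc⟩ := exists_between hc
      exact (upperBaire_le_of_eventually
        ((hA.eventually_upper hd).mono fun y hy => (hle y).2.trans hy.le)).trans_lt hdc
    · refine le_of_not_gt fun h => ?_
      obtain ⟨c, hc', hc⟩ := exists_between h
      obtain ⟨y, hy, hy'⟩ := ((h₁ x c hc).and_eventually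
        (eventually_lt_of_upperBaire_lt hg hc')).exists
      exact (((hle y).1.trans (g y).fst_le_snd).trans_lt hy').not_gt hy

theorem graphCompletion_self (f : HFun X) (x : X) :
    graphCompletion f f.locallyBounded x = f x :=
  f.hausdorff f f.locallyBounded (fun _ => subset_rfl) x

theorem isSemicontinuous (f : HFun X) : IsSemicontinuous f where
  lower := by
    convert lowerSemicontinuous_lowerBaire f.locallyBounded using 2 with x
    exact (congrArg (fun a => a.fst) (f.graphCompletion_self x)).symm
  upper := by
    convert upperSemicontinuous_upperBaire f.locallyBounded using 2 with x
    exact (congrArg (fun a => a.snd) (f.graphCompletion_self x)).symm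

/-- The lower end point, as a point-valued function, is contained in f, so its graph completion is
f; its upper Baire function is therefore the upper end point of f. -/
theorem frequently_lt_fst (f : HFun X) {x : X} {c : ℝ} (hc : c < (f x).snd) :
    ∃ᶠ y in 𝓝 x, c < (f y).fst := by
  have hb : LocallyBounded fun y => NonemptyInterval.pure (f y).fst :=
    .of_eventually fun x => (f.isSemicontinuous.eventually_bounded x).imp fun M hM =>
      hM.mono fun y hy => ⟨hy.1, (f y).fst_le_snd.trans_lt hy.2⟩
  have h := f.hausdorff _ hb (fun y => NonemptyInterval.coe_subset_coe.2
    (NonemptyInterval.le_def.2 ⟨le_rfl, (f y).fst_le_snd⟩)) x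
  exact frequently_lt_of_lt_upperBaire (hc.trans_eq (congrArg (fun a => a.snd) h).symm)

theorem frequently_snd_lt (f : HFun X) {x : X} {c : ℝ} (hc : (f x).fst < c) :
    ∃ᶠ y in 𝓝 x, (f y).snd < c := by
  have hb : LocallyBounded fun y => NonemptyInterval.pure (f y).snd :=
    .of_eventually fun x => (f.isSemicontinuous.eventually_bounded x).imp fun M hM =>
      hM.mono fun y hy => ⟨hy.1.trans_le (f y).fst_le_snd, hy.2⟩
  have h := f.hausdorff _ hb (fun y => NonemptyInterval.coe_subset_coe.2
    (NonemptyInterval.le_def.2 ⟨(f y).fst_le_snd, le_rfl⟩)) x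
  exact frequently_lt_of_lowerBaire_lt ((congrArg (fun a => a.fst) h).trans_lt hc)

/-- By rigidity one end point determines the other: if g.fst < c < f.fst at x, then at some nearby y
both g.snd < c and c < f.fst. -/
theorem le_of_snd_le {f g : HFun X} (h : ∀ x, (f x).snd ≤ (g x).snd) : f ≤ g := by
  refine fun x => ⟨le_of_not_gt fun hx => ?_, h x⟩
  obtain ⟨c, hc, hc'⟩ := exists_between hx
  obtain ⟨y, hy, hy'⟩ := ((g.frequently_snd_lt hc).and_eventually
    (f.isSemicontinuous.eventually_lower hc')).exists
  exact (hy'.trans_le ((f y).fst_le_snd.trans (h y))).not_gt hy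

theorem le_of_fst_le {f g : HFun X} (h : ∀ x, (f x).fst ≤ (g x).fst) : f ≤ g := by
  refine le_of_snd_le fun x => le_of_not_gt fun hx => ?_
  obtain ⟨c, hc, hc'⟩ := exists_between hx
  obtain ⟨y, hy, hyc⟩ := ((f.frequently_lt_fst hc').and_eventually
    (g.isSemicontinuous.eventually_upper hc)).exists
  exact (hy.trans_le ((h y).trans (g y).fst_le_snd)).not_gt hyc

/-- The set of points at which a Hausdorff continuous function is narrow is dense. -/
theorem frequently_width_lt (f : HFun X) (x : X) {ε : ℝ} (hε : 0 < ε) :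
    ∃ᶠ y in 𝓝 x, (f y).snd - (f y).fst < ε := by
  refine ((f.frequently_snd_lt (c := (f x).fst + ε / 2) (by linarith)).and_eventually
    (f.isSemicontinuous.eventually_lower (c := (f x).fst - ε / 2) (by linarith))).mono ?_
  rintro y ⟨h1, h2⟩
  linarith

/-- The least Hausdorff continuous function whose lower end point is above that of a given
semicontinuous interval function. -/
theorem exists_lower_hull {A : X → NonemptyInterval ℝ} (hA : IsSemicontinuous A) :
    ∃ h : HFun X, (∀ x, h x ≤ A x) ∧
      ∀ x c, c < (h x).snd → ∃ᶠ y in 𝓝 x, c < (A y).fst := by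
  have hb : LocallyBounded fun y => NonemptyInterval.pure (A y).fst :=
    .of_eventually fun x => (hA.eventually_bounded x).imp fun M hM =>
      hM.mono fun y hy => ⟨hy.1, (A y).fst_le_snd.trans_lt hy.2⟩
  -- The hull is [I(S(a)), S(a)] with a the lower end point of A. Semicontinuity of A keeps it
  -- inside A, and both rigidity conditions come from the Baire operators.
  set u : X → ℝ := upperBaire fun y => NonemptyInterval.pure (A y).fst
  have hAu : ∀ x, (A x).fst ≤ u x := le_upperBaire hb
  have huA : ∀ x, u x ≤ (A x).snd := fun x => le_of_forall_gt fun c hc => by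
    obtain ⟨d, hd, hdc⟩ := exists_between hc
    exact (upperBaire_le_of_eventually ((hA.eventually_upper hd).mono fun y hy =>
      (A y).fst_le_snd.trans hy.le)).trans_lt hdc
  have hb' : LocallyBounded fun y => NonemptyInterval.pure (u y) :=
    .of_eventually fun x => (hA.eventually_bounded x).imp fun M hM =>
      hM.mono fun y hy => ⟨hy.1.trans_le (hAu y), (huA y).trans_lt hy.2⟩
  set l : X → ℝ := lowerBaire fun y => NonemptyInterval.pure (u y)
  have hAl : ∀ x, (A x).fst ≤ l x := fun x => le_of_forall_lt fun c hc => by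
    obtain ⟨d, hcd, hd⟩ := exists_between hc
    exact hcd.trans_le (le_lowerBaire_of_eventually ((hA.eventually_lower hd).mono fun y hy =>
      hy.le.trans (hAu y)))
  have hfreq : ∀ x c, c < u x → ∃ᶠ y in 𝓝 x, c < (A y).fst := fun x c hc =>
    frequently_lt_of_lt_upperBaire hc
  refine ⟨ofIsSemicontinuous (fun x => ⟨(l x, u x), lowerBaire_le hb' x⟩)
    ⟨lowerSemicontinuous_lowerBaire hb', upperSemicontinuous_upperBaire hb⟩
    (fun x c hc => (hfreq x c hc).mono fun y hy => hy.trans_le (hAl y))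
    (fun x c hc => frequently_lt_of_lowerBaire_lt hc), fun x => ?_, hfreq⟩
  exact NonemptyInterval.le_def.2 ⟨hAl x, huA x⟩

/-- The pointwise negative of a Hausdorff continuous function. -/
def neg (f : HFun X) : HFun X :=
  ofIsSemicontinuous (fun x => -f x) f.isSemicontinuous.neg
    (fun _ _ hc => (f.frequently_snd_lt (lt_neg.1 hc)).mono fun _ hy => lt_neg.1 hy)
    (fun _ _ hc => (f.frequently_lt_fst (neg_lt.1 hc)).mono fun _ hy => neg_lt.1 hy)

/-- The greatest Hausdorff continuous function whose upper end point is below that of a given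
semicontinuous interval function. -/
theorem exists_upper_hull {A : X → NonemptyInterval ℝ} (hA : IsSemicontinuous A) :
    ∃ h : HFun X, (∀ x, h x ≤ A x) ∧
      ∀ x c, (h x).fst < c → ∃ᶠ y in 𝓝 x, (A y).snd < c := by
  obtain ⟨h, h1, h2⟩ := exists_lower_hull hA.neg
  refine ⟨h.neg, fun x => ?_, fun x c hc => (h2 x (-c) ?_).mono fun y hy => ?_⟩
  · have := NonemptyInterval.le_def.1 (h1 x)
    exact NonemptyInterval.le_def.2 ⟨le_neg.1 this.2, neg_le.1 this.1⟩
  · exact neg_lt.1 hc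
  · exact neg_lt_neg_iff.1 hy

end HFun

/-! ### Enclosures and order convergence. -/

section Enclosure

variable {X : Type*} [PseudoMetricSpace X]

/-- A decreasing sequence of semicontinuous interval functions that becomes arbitrarily narrow on
a dense set of points. -/
structure IsEnclosure (A : ℕ → X → NonemptyInterval ℝ) : Prop where
  semicontinuous : ∀ n, IsSemicontinuous (A n)
  antitone : ∀ x, Antitone fun n => A n x
  narrow : ∀ x, ∀ ε > 0, ∃ᶠ y in 𝓝 x, ∃ n, (A n y).snd - (A n y).fst < ε

theorem width_mono {a b : NonemptyInterval ℝ} (h : a ≤ b) :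
    a.snd - a.fst ≤ b.snd - b.fst := by
  have := NonemptyInterval.le_def.1 h
  linarith

theorem HFun.isEnclosure_const (f : HFun X) : IsEnclosure fun _ : ℕ => f.toFun where
  semicontinuous _ := f.isSemicontinuous
  antitone _ := antitone_const
  narrow x _ hε := (f.frequently_width_lt x hε).mono fun _ hy => ⟨0, hy⟩

/-- Two enclosures become narrow simultaneously. -/
theorem IsEnclosure.narrow₂ {A B : ℕ → X → NonemptyInterval ℝ} (hA : IsEnclosure A)
    (hB : IsEnclosure B) (x : X) {ε : ℝ} (hε : 0 < ε) :
    ∃ᶠ y in 𝓝 x, ∃ n, (A n y).snd - (A n y).fst < ε ∧ (B n y).snd - (B n y).fst < ε := by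
  refine frequently_frequently_nhds.1 ((hA.narrow x ε hε).mono ?_)
  rintro y ⟨n, hn⟩
  -- A n stays narrow near y, so a narrow point of B can be chosen there; the larger index serves
  -- both.
  refine ((hB.narrow y ε hε).and_eventually ((hA.semicontinuous n).eventually_width hn)).mono ?_
  rintro z ⟨⟨m, hm⟩, hz⟩
  exact ⟨max n m,
    (width_mono (hA.antitone z (le_max_left n m))).trans_lt hz,
    (width_mono (hB.antitone z (le_max_right n m))).trans_lt hm⟩

theorem IsEnclosure.le {A : ℕ → X → NonemptyInterval ℝ} (hA : IsEnclosure A) {p r : HFun X}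
    (hr : ∀ n x, (A n x).fst ≤ (r x).fst) (hp : ∀ n x, (p x).snd ≤ (A n x).snd) : p ≤ r := by
  refine HFun.le_of_snd_le fun x => le_of_not_gt fun hx => ?_
  -- One third each for the drop of p, the rise of r and the width of A n, all controlled at a
  -- common point z.
  set ε := ((p x).snd - (r x).snd) / 3 with hε
  have hr' := (r.isSemicontinuous.eventually_upper (x := x) (c := (r x).snd + ε)
    (by linarith)).eventually_nhds
  obtain ⟨y, hy, hyr⟩ := ((p.frequently_lt_fst (x := x) (c := (p x).snd - ε)
    (by linarith)).and_eventually hr').exists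
  obtain ⟨z, ⟨n, hn⟩, hz, hzr⟩ := ((hA.narrow y ε (by linarith)).and_eventually
    ((p.isSemicontinuous.eventually_lower hy).and hyr)).exists
  have h1 := hr n z
  have h2 := hp n z
  have h3 := (p z).fst_le_snd
  have h4 := (r z).fst_le_snd
  linarith

theorem IsEnclosure.eq {A : ℕ → X → NonemptyInterval ℝ} (hA : IsEnclosure A) {p r : HFun X}
    (hp : ∀ n x, p x ≤ A n x) (hr : ∀ n x, r x ≤ A n x) : p = r :=
  le_antisymm (hA.le (fun n x => (hr n x).1) fun n x => (hp n x).2)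
    (hA.le (fun n x => (hp n x).1) fun n x => (hr n x).2)

/-- The bounds are the hulls of A n: α n is the least Hausdorff continuous function above its lower
end point, β n the greatest below its upper one. Extremality gives monotonicity and the bounds on ξ
and p; `IsEnclosure.le` identifies the supremum and infimum. -/
theorem IsEnclosure.orderConverges {A : ℕ → X → NonemptyInterval ℝ} (hA : IsEnclosure A)
    {ξ : ℕ → HFun X} {p : HFun X} (hξ : ∀ n x, ξ n x ≤ A n x) (hp : ∀ n x, p x ≤ A n x) :
    OrderConverges ξ p := by
  choose α hα hα' using fun n => HFun.exists_lower_hull (hA.semicontinuous n)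
  choose β hβ hβ' using fun n => HFun.exists_upper_hull (hA.semicontinuous n)
  have hα_le : ∀ n (r : HFun X), (∀ x, (A n x).fst ≤ (r x).fst) → α n ≤ r := by
    refine fun n r hr => HFun.le_of_snd_le fun x => le_of_not_gt fun hx => ?_
    obtain ⟨c, hc, hc'⟩ := exists_between hx
    obtain ⟨y, hy, hy'⟩ := ((hα' n x c hc').and_eventually
      (r.isSemicontinuous.eventually_upper hc)).exists
    exact (hy.trans_le ((hr y).trans (r y).fst_le_snd)).not_gt hy'
  have hle_β : ∀ n (r : HFun X), (∀ x, (r x).snd ≤ (A n x).snd) → r ≤ β n := by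
    refine fun n r hr => HFun.le_of_fst_le fun x => le_of_not_gt fun hx => ?_
    obtain ⟨c, hc, hc'⟩ := exists_between hx
    obtain ⟨y, hy, hy'⟩ := ((hβ' n x c hc).and_eventually
      (r.isSemicontinuous.eventually_lower hc')).exists
    exact (hy'.trans_le ((r y).fst_le_snd.trans (hr y))).not_gt hy
  refine ⟨α, β, fun n m hnm => hα_le n _ fun x => ?_, fun n m hnm => hle_β n _ fun x => ?_,
    fun n => ⟨hα_le n _ fun x => (hξ n x).1, hle_β n _ fun x => (hξ n x).2⟩, ⟨?_, ?_⟩, ⟨?_, ?_⟩⟩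
  · exact (hA.antitone x hnm).1.trans (hα m x).1
  · exact (hβ m x).2.trans (hA.antitone x hnm).2
  · rintro _ ⟨n, rfl⟩
    exact hα_le n p fun x => (hp n x).1
  · exact fun r hr => hA.le (fun n x => (hα n x).1.trans (hr ⟨n, rfl⟩ x).1) fun n x => (hp n x).2
  · rintro _ ⟨n, rfl⟩
    exact hle_β n p fun x => (hp n x).2
  · exact fun r hr => hA.le (fun n x => (hp n x).1) fun n x => (hr ⟨n, rfl⟩ x).2.trans (hβ n x).2

/-- The supremum in the set of Hausdorff continuous functions is approached on a dense set. -/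
theorem frequently_lt_of_isLUB {α : ℕ → HFun X} {f b : HFun X} (hα : IsLUB (Set.range α) f)
    (hb : ∀ n, α n ≤ b) {x : X} {c : ℝ} (hc : c < (f x).snd) :
    ∃ᶠ y in 𝓝 x, ∃ n, c < (α n y).fst := by
  have hbdd : ∀ x, BddAbove (Set.range fun n => (α n x).fst) := fun x =>
    ⟨(b x).fst, by rintro _ ⟨n, rfl⟩; exact (hb n x).1⟩
  -- The hull of the pointwise supremum is an upper bound of all α n, hence above f, and its upper
  -- end point is approached by that supremum.
  obtain ⟨h, h1, h2⟩ := HFun.exists_lower_hull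
    (A := fun x => ⟨(⨆ n, (α n x).fst, (b x).snd),
      (ciSup_le fun n => (hb n x).1).trans (b x).fst_le_snd⟩)
    ⟨lowerSemicontinuous_ciSup hbdd fun n => (α n).isSemicontinuous.lower,
      b.isSemicontinuous.upper⟩
  have hfh : f ≤ h := hα.2 <| by
    rintro _ ⟨n, rfl⟩
    exact HFun.le_of_fst_le fun y => (le_ciSup (hbdd y) n).trans (h1 y).1
  exact (h2 x c (hc.trans_le (hfh x).2)).mono fun y hy => exists_lt_of_lt_ciSup hy

theorem HFun.neg_le_neg {f g : HFun X} (h : f ≤ g) : g.neg ≤ f.neg := fun x =>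
  ⟨neg_le_neg_iff.2 (h x).2, neg_le_neg_iff.2 (h x).1⟩

theorem HFun.neg_neg (f : HFun X) : f.neg.neg = f :=
  HFun.ext <| funext fun x => NonemptyInterval.ext <| Prod.ext
    (_root_.neg_neg (f x).fst) (_root_.neg_neg (f x).snd)

/-- The infimum in the set of Hausdorff continuous functions is approached on a dense set. -/
theorem frequently_lt_of_isGLB {β : ℕ → HFun X} {f b : HFun X} (hβ : IsGLB (Set.range β) f)
    (hb : ∀ n, b ≤ β n) {x : X} {c : ℝ} (hc : (f x).fst < c) :
    ∃ᶠ y in 𝓝 x, ∃ n, (β n y).snd < c := by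
  have hlub : IsLUB (Set.range fun n => (β n).neg) f.neg := by
    refine ⟨?_, fun r hr => ?_⟩
    · rintro _ ⟨n, rfl⟩
      exact HFun.neg_le_neg (hβ.1 ⟨n, rfl⟩)
    · rw [← r.neg_neg]
      refine HFun.neg_le_neg (hβ.2 ?_)
      rintro _ ⟨n, rfl⟩
      rw [← (β n).neg_neg]
      exact HFun.neg_le_neg (hr ⟨n, rfl⟩)
  refine (frequently_lt_of_isLUB hlub (fun n => HFun.neg_le_neg (hb n)) (x := x) (c := -c)
    (neg_lt_neg_iff.2 hc)).mono ?_
  rintro y ⟨n, hn⟩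
  exact ⟨n, neg_lt_neg_iff.1 hn⟩

theorem OrderConverges.exists_isEnclosure {ξ : ℕ → HFun X} {f : HFun X}
    (h : OrderConverges ξ f) :
    ∃ A : ℕ → X → NonemptyInterval ℝ, IsEnclosure A ∧ (∀ n x, ξ n x ≤ A n x) ∧
      ∀ n x, f x ≤ A n x := by
  obtain ⟨α, β, hα, hβ, hξ, hlub, hglb⟩ := h
  have hαf : ∀ n, α n ≤ f := fun n => hlub.1 ⟨n, rfl⟩
  have hfβ : ∀ n, f ≤ β n := fun n => hglb.1 ⟨n, rfl⟩
  refine ⟨fun n x => ⟨((α n x).fst, (β n x).snd),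
      (α n x).fst_le_snd.trans (((hαf n).trans (hfβ n)) x).2⟩,
    ⟨fun n => ⟨(α n).isSemicontinuous.lower, (β n).isSemicontinuous.upper⟩,
      fun x n m hnm => ⟨(hα hnm x).1, (hβ hnm x).2⟩, fun x ε hε => ?_⟩,
    fun n x => ⟨((hξ n).1 x).1, ((hξ n).2 x).2⟩, fun n x => ⟨(hαf n x).1, (hfβ n x).2⟩⟩
  -- Some β n falls below f.fst x + ε/2 at a y near x, hence around y; some α m rises above f.fst x
  -- - ε/2 at a point z of that neighbourhood.
  have h1 := (frequently_lt_of_isGLB hglb hfβ (x := x) (c := (f x).fst + ε / 2)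
    (by linarith)).and_eventually
      (f.isSemicontinuous.eventually_lower (x := x) (c := (f x).fst - ε / 2) (by linarith))
  refine frequently_frequently_nhds.1 (h1.mono ?_)
  rintro y ⟨⟨n, hn⟩, hy⟩
  refine ((frequently_lt_of_isLUB hlub hαf (hy.trans_le (f y).fst_le_snd)).and_eventually
    ((β n).isSemicontinuous.eventually_upper hn)).mono ?_
  rintro z ⟨⟨m, hm⟩, hz⟩
  refine ⟨max n m, ?_⟩
  have h2 := (hα (le_max_right n m) z).1
  have h3 := (hβ (le_max_left n m) z).2
  change (β (max n m) z).snd - (α (max n m) z).fst < ε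
  linarith

end Enclosure

theorem OrderConverges.le {P : Type*} [PartialOrder P] {ξ : ℕ → P} {p q : P}
    (hp : OrderConverges ξ p) (hq : OrderConverges ξ q) : p ≤ q := by
  obtain ⟨α, _, hα, -, hξ, hlub, -⟩ := hp
  obtain ⟨_, β, -, hβ, hξ', -, hglb⟩ := hq
  refine hlub.2 ?_
  rintro _ ⟨n, rfl⟩
  refine hglb.2 ?_
  rintro _ ⟨m, rfl⟩
  exact (hα (le_max_left n m)).trans
    (((hξ _).1.trans (hξ' _).2).trans (hβ (le_max_right n m)))

theorem OrderConverges.isTheOrderLimit {P : Type*} [PartialOrder P] {ξ : ℕ → P} {p : P}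
    (hp : OrderConverges ξ p) : IsTheOrderLimit ξ p :=
  ⟨hp, fun _ hq => le_antisymm (hq.le hp) (hp.le hq)⟩

/-! ### Interval operations as images of boxes. -/

section Image

variable {X : Type*} [PseudoMetricSpace X]

/-- `op a b` is the image of the box `a × b` under the continuous function `m`. -/
structure IsImageOperation (op : NonemptyInterval ℝ → NonemptyInterval ℝ → NonemptyInterval ℝ)
    (m : ℝ → ℝ → ℝ) : Prop where
  mem : ∀ {a b s t}, s ∈ a → t ∈ b → m s t ∈ op a b
  exists_fst : ∀ a b, ∃ s ∈ a, ∃ t ∈ b, m s t = (op a b).fst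
  exists_snd : ∀ a b, ∃ s ∈ a, ∃ t ∈ b, m s t = (op a b).snd
  continuous : Continuous (Function.uncurry m)

variable {op : NonemptyInterval ℝ → NonemptyInterval ℝ → NonemptyInterval ℝ} {m : ℝ → ℝ → ℝ}

theorem IsImageOperation.uniform (h : IsImageOperation op m) (K : ℝ) {ε : ℝ} (hε : 0 < ε) :
    ∃ δ > 0, ∀ s ∈ Set.Icc (-K) K, ∀ t ∈ Set.Icc (-K) K, ∀ s' ∈ Set.Icc (-K) K,
      ∀ t' ∈ Set.Icc (-K) K, |s - s'| < δ → |t - t'| < δ → |m s t - m s' t'| < ε := by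
  have hc : IsCompact (Set.Icc (-K) K ×ˢ Set.Icc (-K) K) := isCompact_Icc.prod isCompact_Icc
  obtain ⟨δ, hδ, H⟩ := Metric.uniformContinuousOn_iff.1
    (hc.uniformContinuousOn_of_continuous h.continuous.continuousOn) ε hε
  exact ⟨δ, hδ, fun s hs t ht s' hs' t' ht' h1 h2 =>
    H (s, t) ⟨hs, ht⟩ (s', t') ⟨hs', ht'⟩ (max_lt h1 h2)⟩

theorem IsImageOperation.mono (h : IsImageOperation op m) {a a' b b' : NonemptyInterval ℝ}
    (ha : a ≤ a') (hb : b ≤ b') : op a b ≤ op a' b' := by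
  obtain ⟨s, hs, t, ht, hst⟩ := h.exists_fst a b
  obtain ⟨s', hs', t', ht', hst'⟩ := h.exists_snd a b
  have key : ∀ {c d : NonemptyInterval ℝ} {r : ℝ}, c ≤ d → r ∈ c → r ∈ d := fun hcd hr =>
    NonemptyInterval.coe_subset_coe.2 hcd hr
  refine NonemptyInterval.le_def.2 ⟨?_, ?_⟩
  · rw [← hst]
    exact (NonemptyInterval.mem_def.1 (h.mem (key ha hs) (key hb ht))).1
  · rw [← hst']
    exact (NonemptyInterval.mem_def.1 (h.mem (key ha hs') (key hb ht'))).2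

theorem exists_mem_abs_sub_lt {a b : NonemptyInterval ℝ} {δ r : ℝ} (hδ : 0 < δ)
    (h₁ : b.fst - δ < a.fst) (h₂ : a.snd < b.snd + δ) (hr : r ∈ a) : ∃ s ∈ b, |r - s| < δ := by
  have hb := b.fst_le_snd
  rw [NonemptyInterval.mem_def] at hr
  rcases lt_or_ge r b.fst with h | h
  · exact ⟨b.fst, NonemptyInterval.mem_def.2 ⟨le_rfl, hb⟩, abs_lt.2 ⟨by linarith, by linarith⟩⟩
  rcases lt_or_ge b.snd r with h' | h'
  · exact ⟨b.snd, NonemptyInterval.mem_def.2 ⟨hb, le_rfl⟩, abs_lt.2 ⟨by linarith, by linarith⟩⟩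
  · exact ⟨r, NonemptyInterval.mem_def.2 ⟨h, h'⟩, by simpa using hδ⟩

theorem IsSemicontinuous.exists_bound_pair {A B : X → NonemptyInterval ℝ}
    (hA : IsSemicontinuous A) (hB : IsSemicontinuous B) (x : X) :
    ∃ K : ℝ, ∀ᶠ y in 𝓝 x, (∀ s ∈ A y, s ∈ Set.Icc (-K) K) ∧ ∀ t ∈ B y, t ∈ Set.Icc (-K) K := by
  obtain ⟨K, hK⟩ := hA.eventually_bounded x
  obtain ⟨L, hL⟩ := hB.eventually_bounded x
  refine ⟨max K L, ?_⟩
  have h1 := le_max_left K L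
  have h2 := le_max_right K L
  filter_upwards [hK, hL] with y hy hy'
  refine ⟨fun s hs => ?_, fun s hs => ?_⟩ <;>
  · rw [NonemptyInterval.mem_def] at hs
    constructor <;> linarith

/-- Nearby values of `op (A y) (B y)` are almost values of `op (A x) (B x)`. -/
theorem IsImageOperation.eventually_near (h : IsImageOperation op m)
    {A B : X → NonemptyInterval ℝ} (hA : IsSemicontinuous A) (hB : IsSemicontinuous B) (x : X)
    {ε : ℝ} (hε : 0 < ε) :
    ∀ᶠ y in 𝓝 x, ∀ s ∈ A y, ∀ t ∈ B y, ∃ r ∈ op (A x) (B x), |m s t - r| < ε := by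
  obtain ⟨K, hK⟩ := hA.exists_bound_pair hB x
  obtain ⟨δ, hδ, hm⟩ := h.uniform K hε
  have hKx := hK.self_of_nhds
  filter_upwards [hK, hA.eventually_lower (sub_lt_self (A x).fst hδ),
    hA.eventually_upper (lt_add_of_pos_right (A x).snd hδ),
    hB.eventually_lower (sub_lt_self (B x).fst hδ),
    hB.eventually_upper (lt_add_of_pos_right (B x).snd hδ)] with y hKy h1 h2 h3 h4 s hs t ht
  obtain ⟨s', hs', hss'⟩ := exists_mem_abs_sub_lt hδ h1 h2 hs
  obtain ⟨t', ht', htt'⟩ := exists_mem_abs_sub_lt hδ h3 h4 ht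
  exact ⟨m s' t', h.mem hs' ht', hm s (hKy.1 s hs) t (hKy.2 t ht) s' (hKx.1 s' hs')
    t' (hKx.2 t' ht') hss' htt'⟩

theorem IsImageOperation.isSemicontinuous (h : IsImageOperation op m)
    {A B : X → NonemptyInterval ℝ} (hA : IsSemicontinuous A) (hB : IsSemicontinuous B) :
    IsSemicontinuous fun x => op (A x) (B x) where
  lower := lowerSemicontinuous_iff.2 fun x c hc => by
    filter_upwards [h.eventually_near hA hB x (sub_pos.2 hc)] with y hy
    obtain ⟨s, hs, t, ht, hst⟩ := h.exists_fst (A y) (B y)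
    obtain ⟨r, hr, hr'⟩ := hy s hs t ht
    rw [NonemptyInterval.mem_def] at hr
    have := (abs_lt.1 hr').1
    linarith
  upper := upperSemicontinuous_iff.2 fun x c hc => by
    filter_upwards [h.eventually_near hA hB x (sub_pos.2 hc)] with y hy
    obtain ⟨s, hs, t, ht, hst⟩ := h.exists_snd (A y) (B y)
    obtain ⟨r, hr, hr'⟩ := hy s hs t ht
    rw [NonemptyInterval.mem_def] at hr
    have := (abs_lt.1 hr').2
    linarith

/-- Near x all A n and B n stay in one compact box, that of index 0, where uniform continuity of m
turns simultaneous narrowness into narrowness of the image. -/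
theorem IsImageOperation.isEnclosure (h : IsImageOperation op m)
    {A B : ℕ → X → NonemptyInterval ℝ} (hA : IsEnclosure A) (hB : IsEnclosure B) :
    IsEnclosure fun n x => op (A n x) (B n x) where
  semicontinuous n := h.isSemicontinuous (hA.semicontinuous n) (hB.semicontinuous n)
  antitone x _ _ hnm := h.mono (hA.antitone x hnm) (hB.antitone x hnm)
  narrow x ε hε := by
    obtain ⟨K, hK⟩ := (hA.semicontinuous 0).exists_bound_pair (hB.semicontinuous 0) x
    obtain ⟨δ, hδ, hm⟩ := h.uniform K hε
    refine ((hA.narrow₂ hB x hδ).and_eventually hK).mono ?_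
    rintro y ⟨⟨n, hn1, hn2⟩, hKA, hKB⟩
    refine ⟨n, ?_⟩
    have hA0 : ∀ s ∈ A n y, s ∈ Set.Icc (-K) K := fun s hs =>
      hKA s (NonemptyInterval.coe_subset_coe.2 (hA.antitone y n.zero_le) hs)
    have hB0 : ∀ s ∈ B n y, s ∈ Set.Icc (-K) K := fun s hs =>
      hKB s (NonemptyInterval.coe_subset_coe.2 (hB.antitone y n.zero_le) hs)
    obtain ⟨s, hs, t, ht, hst⟩ := h.exists_snd (A n y) (B n y)
    obtain ⟨s', hs', t', ht', hst'⟩ := h.exists_fst (A n y) (B n y)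
    have hdist : ∀ {a : NonemptyInterval ℝ} {p q : ℝ}, a.snd - a.fst < δ → p ∈ a → q ∈ a →
        |p - q| < δ := fun ha hp hq => by
      rw [NonemptyInterval.mem_def] at hp hq
      exact abs_lt.2 ⟨by linarith, by linarith⟩
    have := hm s (hA0 s hs) t (hB0 t ht) s' (hA0 s' hs') t' (hB0 t' ht') (hdist hn1 hs hs')
      (hdist hn2 ht ht')
    rw [hst, hst'] at this
    exact (abs_lt.1 this).2

theorem isImageOperation_add : IsImageOperation (fun a b => a + b) fun s t => s + t where
  mem ha hb := ⟨add_le_add ha.1 hb.1, add_le_add ha.2 hb.2⟩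
  exists_fst a b := ⟨a.fst, ⟨le_rfl, a.fst_le_snd⟩, b.fst, ⟨le_rfl, b.fst_le_snd⟩, rfl⟩
  exists_snd a b := ⟨a.snd, ⟨a.fst_le_snd, le_rfl⟩, b.snd, ⟨b.fst_le_snd, le_rfl⟩, rfl⟩
  continuous := continuous_add

theorem mul_mem_min_max {u v r : ℝ} (q : ℝ) (h₁ : u ≤ r) (h₂ : r ≤ v) :
    min (u * q) (v * q) ≤ r * q ∧ r * q ≤ max (u * q) (v * q) := by
  rcases le_total 0 q with hq | hq
  · exact ⟨min_le_of_left_le (mul_le_mul_of_nonneg_right h₁ hq),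
      le_max_of_le_right (mul_le_mul_of_nonneg_right h₂ hq)⟩
  · exact ⟨min_le_of_right_le (mul_le_mul_of_nonpos_right h₂ hq),
      le_max_of_le_left (mul_le_mul_of_nonpos_right h₁ hq)⟩

/-- A product is linear in each factor separately, so its extremes over a box are attained at
corners. -/
theorem isImageOperation_mul : IsImageOperation intervalMul fun s t => s * t where
  mem {a b s t} ha hb := by
    have h1 := mul_mem_min_max t ha.1 ha.2
    have h2 := mul_mem_min_max a.fst hb.1 hb.2
    have h3 := mul_mem_min_max a.snd hb.1 hb.2
    simp only [mul_comm _ a.fst, mul_comm _ a.snd] at h2 h3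
    exact ⟨(min_le_min h2.1 h3.1).trans h1.1, h1.2.trans (max_le_max h2.2 h3.2)⟩
  exists_fst a b := by
    have h1 : a.fst ∈ a := ⟨le_rfl, a.fst_le_snd⟩
    have h2 : a.snd ∈ a := ⟨a.fst_le_snd, le_rfl⟩
    have h3 : b.fst ∈ b := ⟨le_rfl, b.fst_le_snd⟩
    have h4 : b.snd ∈ b := ⟨b.fst_le_snd, le_rfl⟩
    simp only [intervalMul]
    rcases min_choice (min (a.fst * b.fst) (a.fst * b.snd))
      (min (a.snd * b.fst) (a.snd * b.snd)) with h | h <;> rw [h]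
    · rcases min_choice (a.fst * b.fst) (a.fst * b.snd) with h | h <;> rw [h]
      exacts [⟨_, h1, _, h3, rfl⟩, ⟨_, h1, _, h4, rfl⟩]
    · rcases min_choice (a.snd * b.fst) (a.snd * b.snd) with h | h <;> rw [h]
      exacts [⟨_, h2, _, h3, rfl⟩, ⟨_, h2, _, h4, rfl⟩]
  exists_snd a b := by
    have h1 : a.fst ∈ a := ⟨le_rfl, a.fst_le_snd⟩
    have h2 : a.snd ∈ a := ⟨a.fst_le_snd, le_rfl⟩
    have h3 : b.fst ∈ b := ⟨le_rfl, b.fst_le_snd⟩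
    have h4 : b.snd ∈ b := ⟨b.fst_le_snd, le_rfl⟩
    simp only [intervalMul]
    rcases max_choice (max (a.fst * b.fst) (a.fst * b.snd))
      (max (a.snd * b.fst) (a.snd * b.snd)) with h | h <;> rw [h]
    · rcases max_choice (a.fst * b.fst) (a.fst * b.snd) with h | h <;> rw [h]
      exacts [⟨_, h1, _, h3, rfl⟩, ⟨_, h1, _, h4, rfl⟩]
    · rcases max_choice (a.snd * b.fst) (a.snd * b.snd) with h | h <;> rw [h]
      exacts [⟨_, h2, _, h3, rfl⟩, ⟨_, h2, _, h4, rfl⟩]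
  continuous := continuous_mul

end Image

/-! ### Monotone approximation by continuous functions. -/

section Approximation

variable {X : Type*} [PseudoMetricSpace X]

/-- A lower semicontinuous nonnegative function is the limit of an increasing sequence of
continuous functions, namely of its Lipschitz regularizations. -/
theorem exists_continuous_monotone_of_nonneg {φ : X → ℝ} (hφ : LowerSemicontinuous φ)
    (h0 : ∀ x, 0 ≤ φ x) :
    ∃ l : ℕ → C(X, ℝ), Monotone l ∧ (∀ n x, l n x ≤ φ x) ∧ ∀ x c, c < φ x → ∃ n, c ≤ l n x := by
  have hnn : ∀ (n : ℕ) x y, 0 ≤ φ y + n * dist x y := fun n x y =>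
    add_nonneg (h0 y) (mul_nonneg n.cast_nonneg dist_nonneg)
  have hbdd : ∀ (n : ℕ) x, BddBelow (Set.range fun y => φ y + n * dist x y) := fun n x =>
    ⟨0, by rintro _ ⟨y, rfl⟩; exact hnn n x y⟩
  have hlip : ∀ n : ℕ, LipschitzWith n fun x => ⨅ y, φ y + n * dist x y := fun n =>
    LipschitzWith.of_le_add_mul _ fun x x' => by
      have : Nonempty X := ⟨x⟩
      rw [← sub_le_iff_le_add]
      refine le_ciInf fun y => ?_
      have h1 := ciInf_le (hbdd n x) y
      have h2 := mul_le_mul_of_nonneg_left (dist_triangle x x' y) (n.cast_nonneg (α := ℝ))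
      simp only [NNReal.coe_natCast]
      linarith
  refine ⟨fun n => ⟨_, (hlip n).continuous⟩, fun n k hnk x => ?_, fun n x => ?_, fun x c hc => ?_⟩
  · have : Nonempty X := ⟨x⟩
    refine ciInf_mono (hbdd n x) fun y => ?_
    have : (n : ℝ) ≤ k := Nat.cast_le.2 hnk
    have := mul_le_mul_of_nonneg_right this (dist_nonneg (x := x) (y := y))
    linarith
  · simpa using ciInf_le (hbdd n x) x
  · have : Nonempty X := ⟨x⟩
    obtain ⟨δ, hδ, h⟩ := Metric.eventually_nhds_iff_ball.1 (lowerSemicontinuous_iff.1 hφ x c hc)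
    -- Inside the ball φ exceeds c already; outside it the penalty is at least nδ ≥ c and φ ≥ 0.
    obtain ⟨n, hn⟩ := exists_nat_ge (c / δ)
    refine ⟨n, le_ciInf fun y => ?_⟩
    have h1 : 0 ≤ (n : ℝ) * dist x y := mul_nonneg n.cast_nonneg dist_nonneg
    by_cases hy : y ∈ Metric.ball x δ
    · have := h y hy
      linarith
    · rw [Metric.mem_ball, not_lt, dist_comm] at hy
      have h2 := (div_le_iff₀ hδ).1 hn
      have h3 := mul_le_mul_of_nonneg_left hy (n.cast_nonneg (α := ℝ))
      have := h0 y
      linarith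

end Approximation

/-! ### Approximating sequences, and agreement of the two definitions. -/

section Operations

variable {X : Type*} [MetricSpace X]

/-- A real lower semicontinuous function on a metric space is the limit of an increasing sequence
of continuous functions. -/
theorem exists_continuous_monotone {φ : X → ℝ} (hφ : LowerSemicontinuous φ) :
    ∃ l : ℕ → C(X, ℝ), Monotone l ∧ (∀ n x, l n x ≤ φ x) ∧ ∀ x c, c < φ x → ∃ n, c ≤ l n x := by
  -- Lower semicontinuity makes the constant φ x - 1 a minorant near x; gluing these gives a
  -- continuous minorant b, and φ - b is nonnegative.
  obtain ⟨b, hb⟩ := exists_continuous_forall_mem_convex_of_local_const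
    (t := fun x => Set.Iic (φ x)) (fun x => convex_Iic _) fun x =>
      ⟨φ x - 1, (lowerSemicontinuous_iff.1 hφ x _ (sub_one_lt _)).mono fun y hy => hy.le⟩
  obtain ⟨l, hl, hlφ, hl'⟩ := exists_continuous_monotone_of_nonneg (φ := fun x => φ x + -b x)
    (hφ.add b.continuous.neg.lowerSemicontinuous) fun x => by
      have : b x ≤ φ x := hb x
      linarith
  refine ⟨fun n => l n + b, fun n k hnk => add_le_add_left (hl hnk) b, fun n x => ?_,
    fun x c hc => ?_⟩
  · have := hlφ n x
    change l n x + b x ≤ φ x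
    linarith
  · obtain ⟨n, hn⟩ := hl' x (c - b x) (by linarith)
    refine ⟨n, ?_⟩
    change c ≤ l n x + b x
    linarith

theorem exists_continuous_antitone {ψ : X → ℝ} (hψ : UpperSemicontinuous ψ) :
    ∃ u : ℕ → C(X, ℝ), Antitone u ∧ (∀ n x, ψ x ≤ u n x) ∧ ∀ x c, ψ x < c → ∃ n, u n x ≤ c := by
  obtain ⟨l, hl, hlψ, hl'⟩ := exists_continuous_monotone (φ := fun x => -ψ x)
    (lowerSemicontinuous_iff.2 fun x c hc =>
      (upperSemicontinuous_iff.1 hψ x (-c) (lt_neg.1 hc)).mono fun _ hy => lt_neg.1 hy)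
  refine ⟨fun n => -l n, fun n k hnk => neg_le_neg (hl hnk), fun n x => ?_, fun x c hc => ?_⟩
  · exact le_neg.1 (hlψ n x)
  · obtain ⟨n, hn⟩ := hl' x (-c) (neg_lt_neg hc)
    exact ⟨n, neg_le.1 hn⟩

theorem exists_approximates (f : HFun X) : ∃ u : ℕ → C(X, ℝ), Approximates u f := by
  obtain ⟨l, hl, hlf, hl'⟩ := exists_continuous_monotone f.isSemicontinuous.lower
  obtain ⟨u, hu, huf, hu'⟩ := exists_continuous_antitone f.isSemicontinuous.upper
  have hlu : ∀ n x, l n x ≤ u n x := fun n x =>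
    (hlf n x).trans ((f x).fst_le_snd.trans (huf n x))
  have hE : IsEnclosure fun n x => (⟨(l n x, u n x), hlu n x⟩ : NonemptyInterval ℝ) := by
    refine ⟨fun n => ⟨(l n).continuous.lowerSemicontinuous, (u n).continuous.upperSemicontinuous⟩,
      fun x n k hnk => ⟨hl hnk x, hu hnk x⟩, fun x ε hε => ?_⟩
    refine (f.frequently_width_lt x (ε := ε / 3) (by linarith)).mono fun y hy => ?_
    obtain ⟨n, hn⟩ := hl' y ((f y).fst - ε / 3) (by linarith)
    obtain ⟨k, hk⟩ := hu' y ((f y).snd + ε / 3) (by linarith)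
    refine ⟨max n k, ?_⟩
    have h1 : l n y ≤ l (max n k) y := hl (le_max_left n k) y
    have h2 : u (max n k) y ≤ u k y := hu (le_max_right n k) y
    change u (max n k) y - l (max n k) y < ε
    linarith
  -- The lower approximations l serve as the sequence, with Cauchy bound u n - l n. A continuous
  -- minorant of all these gaps that is positive at x would stay away from 0 near x, against
  -- narrowness.
  refine ⟨l, ⟨fun n => u n - l n, fun n k hnk => sub_le_sub (hu hnk) (hl hnk), ⟨?_, ?_⟩, ?_⟩,
    hE.orderConverges (fun n x => ⟨le_rfl, hlu n x⟩) fun n x => ⟨hlf n x, huf n x⟩⟩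
  · rintro _ ⟨n, rfl⟩ x
    exact sub_nonneg.2 (hlu n x)
  · intro c hc x
    change c x ≤ 0
    refine le_of_not_gt fun hx => ?_
    obtain ⟨y, ⟨n, hn⟩, hy⟩ := ((hE.narrow x (c x / 2) (half_pos hx)).and_eventually
      (c.continuous.continuousAt.eventually_const_lt (half_lt_self hx))).exists
    have h1 : c y ≤ u n y - l n y := hc ⟨n, rfl⟩ y
    exact (hy.trans_le h1).not_gt hn
  · intro n k j hk hj x
    have h1 : l n x ≤ l j x := hl hj x
    have h2 := hlf k x
    have h3 := huf n x
    have h4 := (f x).fst_le_snd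
    change l k x - l j x ≤ u n x - l n x
    linarith

variable {op : NonemptyInterval ℝ → NonemptyInterval ℝ → NonemptyInterval ℝ} {m : ℝ → ℝ → ℝ}

theorem IsImageOperation.existsUnique (hop : IsImageOperation op m) (f g : HFun X) :
    ∃! h : HFun X, ∀ x, (h x : Set ℝ) ⊆ (op (f x) (g x) : Set ℝ) := by
  obtain ⟨h, hh, -⟩ := HFun.exists_lower_hull
    (hop.isSemicontinuous f.isSemicontinuous g.isSemicontinuous)
  refine ⟨h, fun x => NonemptyInterval.coe_subset_coe.2 (hh x), fun r hr => ?_⟩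
  exact (hop.isEnclosure f.isEnclosure_const g.isEnclosure_const).eq
    (fun _ x => NonemptyInterval.coe_subset_coe.1 (hr x)) fun _ x => hh x

theorem IsImageOperation.isTheOrderLimit (hop : IsImageOperation op m) {f g h : HFun X}
    (hh : ∀ x, (h x : Set ℝ) ⊆ (op (f x) (g x) : Set ℝ)) {u v w : ℕ → C(X, ℝ)}
    (hu : OrderConverges (fun n => ofContinuous (u n)) f)
    (hv : OrderConverges (fun n => ofContinuous (v n)) g) (hw : ∀ n x, w n x = m (u n x) (v n x)) :
    IsTheOrderLimit (fun n => ofContinuous (w n)) h := by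
  obtain ⟨A, hA, huA, hfA⟩ := hu.exists_isEnclosure
  obtain ⟨B, hB, hvB, hgB⟩ := hv.exists_isEnclosure
  refine ((hop.isEnclosure hA hB).orderConverges (fun n x => ?_) fun n x =>
    (NonemptyInterval.coe_subset_coe.1 (hh x)).trans
      (hop.mono (hfA n x) (hgB n x))).isTheOrderLimit
  -- For a degenerate interval, inclusion unfolds to membership of its point.
  have h1 : w n x ∈ op (A n x) (B n x) := by
    rw [hw]
    exact hop.mem (huA n x) (hvB n x)
  exact h1

/-- The operations defined by inclusion and by order convergence agree. -/
theorem IsImageOperation.inclusion_iff_order (hop : IsImageOperation op m)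
    {w : C(X, ℝ) → C(X, ℝ) → C(X, ℝ)} (hw : ∀ u v x, w u v x = m (u x) (v x)) (f g : HFun X) :
    (∃! h : HFun X, ∀ x, (h x : Set ℝ) ⊆ (op (f x) (g x) : Set ℝ)) ∧
    (∃! h : HFun X, (∃ u v : ℕ → C(X, ℝ), Approximates u f ∧ Approximates v g) ∧
      ∀ u v : ℕ → C(X, ℝ), Approximates u f → Approximates v g →
        IsTheOrderLimit (fun n => ofContinuous (w (u n) (v n))) h) ∧
    ∀ h : HFun X, (∀ x, (h x : Set ℝ) ⊆ (op (f x) (g x) : Set ℝ)) ↔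
      (∃ u v : ℕ → C(X, ℝ), Approximates u f ∧ Approximates v g) ∧
      ∀ u v : ℕ → C(X, ℝ), Approximates u f → Approximates v g →
        IsTheOrderLimit (fun n => ofContinuous (w (u n) (v n))) h := by
  obtain ⟨u, hu⟩ := exists_approximates f
  obtain ⟨v, hv⟩ := exists_approximates g
  obtain ⟨h, hh, hh'⟩ := hop.existsUnique f g
  have hlim : ∀ u v : ℕ → C(X, ℝ), Approximates u f → Approximates v g →
      IsTheOrderLimit (fun n => ofContinuous (w (u n) (v n))) h := fun u v hu hv =>
    hop.isTheOrderLimit hh hu.2 hv.2 fun n => hw (u n) (v n)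
  have huniq : ∀ r : HFun X, (∀ u v : ℕ → C(X, ℝ), Approximates u f → Approximates v g →
      IsTheOrderLimit (fun n => ofContinuous (w (u n) (v n))) r) → r = h := fun r hr =>
    (hlim u v hu hv).2 r (hr u v hu hv).1
  refine ⟨⟨h, hh, hh'⟩, ⟨h, ⟨⟨u, v, hu, hv⟩, hlim⟩, fun r hr => huniq r hr.2⟩, fun r =>
    ⟨fun hr => ?_, fun hr => ?_⟩⟩
  · rw [hh' r hr]
    exact ⟨⟨u, v, hu, hv⟩, hlim⟩
  · rw [huniq r hr.2]
    exact hh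

end Operations

end HausdorffContinuity

/-- For all Hausdorff continuous `f`, `g`, both definitions of the sum and both definitions of
the product determine exactly one Hausdorff continuous function, and it is the same one. -/
theorem theorem7 {n : ℕ} (Ω : Set (EuclideanSpace ℝ (Fin n)))
    (f g : HausdorffContinuity.HFun Ω) :
    ((∃! h, HausdorffContinuity.IsInclusionSum f g h) ∧
      (∃! h, HausdorffContinuity.IsOrderSum f g h) ∧
      ∀ h, HausdorffContinuity.IsInclusionSum f g h ↔ HausdorffContinuity.IsOrderSum f g h) ∧
    ((∃! h, HausdorffContinuity.IsInclusionProd f g h) ∧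
      (∃! h, HausdorffContinuity.IsOrderProd f g h) ∧
      ∀ h, HausdorffContinuity.IsInclusionProd f g h ↔
        HausdorffContinuity.IsOrderProd f g h) := by
  exact ⟨HausdorffContinuity.isImageOperation_add.inclusion_iff_order (fun _ _ _ => rfl) f g,
    HausdorffContinuity.isImageOperation_mul.inclusion_iff_order (fun _ _ _ => rfl) f g⟩
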